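/- **Theorem 2.** Let $p_0,p_1,\dots$ be propositional letters and let $\mathcal{MD}$ be the set of modal formulas built from them with $\wedge,\vee,\to,\sim,\Box$. *The logic $\mathsf{FSK}^d$.* A model is a tuple $(W,\le,R,V^+,V^-)$ where $W\neq\emptyset$, $\le$ is a preorder on $W$, $R\subseteq W\times W$, each $V^{\pm}(p_n)\subseteq W$ is upward closed under $\le$, and: (c1) if $w\le w'$ and $wRv$, then there is $v'$ with $w'Rv'$ and $v\le v'$; (c2) if $wRv$ and $v\le v'$, then there is $w'$ with $w\le w'$ and $w'Rv'$. Verification $\models^+$ and falsification $\models^-$ at a world are defined by: $w\models^{\pm}p$ iff $w\in V^{\pm}(p)$; $w\models^+\sim\varphi$ iff $w\models^-\varphi$, and $w\models^-\sim\varphi$ iff $w\models^+\varphi$; $\wedge$ is verified as "and" and falsified as "or", $\vee$ is verified as "or" and falsified as "and"; $w\models^+\varphi\to\psi$ iff for all $v\ge w$, $v\models^+\varphi$ implies $v\models^+\psi$; $w\models^-\varphi\to\psi$ iff $w\models^+\varphi$ and $w\models^-\psi$; $w\models^+\Box\varphi$ iff $u\models^+\varphi$ whenever $w\le v$ and $vRu$;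 $w\models^-\Box\varphi$ iff there is $u$ with $wRu$ and $u\models^-\varphi$. For $\Gamma,\Delta\subseteq\mathcal{MD}$, $\Gamma\models_{\mathsf{FSK}^d}\Delta$ means that every world of every model which verifies all formulas of $\Gamma$ verifies some formula of $\Delta$. *The logic $\mathsf{QN4}$.* Let $Ind=\{v_0,v_1,\dots\}$ be the individual variables and let $\mathcal{FO}$ be the set of first-order formulas built with $\wedge,\vee,\to,\sim,\forall,\exists$ from atoms $x\equiv y$ and atoms over the unary letters $p_0,p_1,\dots,S,O$, the binary letter $E$ and the ternary letter $R$. The theorems of $\mathsf{QN4}$ are generated by the axiom schemes of positive intuitionistic propositional logic; $\forall x\varphi\to\varphi[x/y]$; $\varphi[x/y]\to\exists x\varphi$; $x\equiv x$; $y\equiv z\to(\varphi[x/y]\to\varphi[x/z])$ (with $y,z$ substitutable for $x$ in $\varphi$); $\sim\sim\varphi\leftrightarrow\varphi$; $\sim(\varphi\wedge\psi)\leftrightarrow(\sim\varphi\vee\sim\psi)$; $\sim(\varphi\vee\psi)\leftrightarrow(\sim\varphi\wedge\sim\psi)$; $\sim(\varphi\to\psi)\leftrightarrow(\varphi\wedge\sim\psi)$;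 $\sim\exists x\varphi\leftrightarrow\forall x\sim\varphi$; $\sim\forall x\varphi\leftrightarrow\exists x\sim\varphi$; and by the rules modus ponens, "from $\psi\to\varphi[x/y]$ infer $\psi\to\forall x\varphi$" and "from $\varphi[x/y]\to\psi$ infer $\exists x\varphi\to\psi$", where $y$ is substitutable for $x$ in $\varphi$ and is not free in the conclusion of the rule. For $\Gamma,\Delta\subseteq\mathcal{FO}$, $\Gamma\models_{\mathsf{QN4}}\Delta$ means that some disjunction $\theta_1\vee\dots\vee\theta_s$ ($s\ge1$) of members of $\Delta$ can be derived from members of $\Gamma$ and theorems of $\mathsf{QN4}$ by modus ponens. *The translation.* Fix for every $x\in Ind$ a variable $y\in Ind$ distinct from $x$. The modal standard translation $\sigma\tau_x:\mathcal{MD}\to\mathcal{FO}$ is given by $\sigma\tau_x(p)=p(x)$, $\sigma\tau_x(\sim\psi)=\sim\sigma\tau_x(\psi)$, $\sigma\tau_x(\psi\ast\chi)=\sigma\tau_x(\psi)\ast\sigma\tau_x(\chi)$ for $\ast\in\{\wedge,\vee,\to\}$, and $\sigma\tau_x(\Box\psi)=\forall y(E(x,y)\to\sigma\tau_y(\psi))$,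 where $y$ is the variable fixed for $x$. *Claim.* For every such choice of variables, all sets $\Gamma,\Delta\subseteq\mathcal{MD}$ and every $x\in Ind$, $$\Gamma\models_{\mathsf{FSK}^d}\Delta\quad\text{iff}\quad\sigma\tau_x(\Gamma)\models_{\mathsf{QN4}}\sigma\tau_x(\Delta),$$ where $\sigma\tau_x(\Gamma)=\{\sigma\tau_x(\varphi)\mid\varphi\in\Gamma\}$, and similarly for $\Delta$. -/

import Mathlib

universe u

namespace NelsonModal

/-! ## The modal language and the logic `FSK^d` -/

/-- Modal formulas over the propositional letters `p_0, p_1, …`. -/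
inductive MD : Type
  | atom : ℕ → MD
  | and : MD → MD → MD
  | or : MD → MD → MD
  | imp : MD → MD → MD
  | neg : MD → MD
  | box : MD → MD

/-- Birelational Nelsonian modal models: a nonempty preorder of worlds, an accessibility relation
satisfying `≤⁻¹ ∘ R ⊆ R ∘ ≤⁻¹` and `R ∘ ≤ ⊆ ≤ ∘ R` (relations composed from left to right), and two
mutually independent persistent valuations. -/
structure FSKdModel where
  World : Type u
  nonempty : Nonempty World
  le : World → World → Prop
  le_refl : ∀ w, le w w
  le_trans : ∀ w v t, le w v → le v t → le w t
  acc : World → World → Prop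
  acc_forth : ∀ w w' v, le w w' → acc w v → ∃ v', acc w' v' ∧ le v v'
  acc_back : ∀ w v v', acc w v → le v v' → ∃ w', le w w' ∧ acc w' v'
  valPos : ℕ → Set World
  valNeg : ℕ → Set World
  valPos_mono : ∀ n w v, le w v → w ∈ valPos n → v ∈ valPos n
  valNeg_mono : ∀ n w v, le w v → w ∈ valNeg n → v ∈ valNeg n

mutual
/-- Verification of a modal formula at a world. -/
def FSKdModel.Pos (M : FSKdModel.{u}) : MD → M.World → Prop
  | .atom n, w => w ∈ M.valPos n
  | .and φ ψ, w => M.Pos φ w ∧ M.Pos ψ w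
  | .or φ ψ, w => M.Pos φ w ∨ M.Pos ψ w
  | .imp φ ψ, w => ∀ v, M.le w v → M.Pos φ v → M.Pos ψ v
  | .neg φ, w => M.Neg φ w
  | .box φ, w => ∀ v, M.le w v → ∀ t, M.acc v t → M.Pos φ t
/-- Falsification of a modal formula at a world. -/
def FSKdModel.Neg (M : FSKdModel.{u}) : MD → M.World → Prop
  | .atom n, w => w ∈ M.valNeg n
  | .and φ ψ, w => M.Neg φ w ∨ M.Neg ψ w
  | .or φ ψ, w => M.Neg φ w ∧ M.Neg ψ w
  | .imp φ ψ, w => M.Pos φ w ∧ M.Neg ψ w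
  | .neg φ, w => M.Pos φ w
  | .box φ, w => ∃ t, M.acc w t ∧ M.Neg φ t
end

/-- `Γ ⊨ Δ` in `FSK^d`: every world of every model that verifies all of `Γ` verifies some member
of `Δ`. -/
def FSKdEntails (Γ Δ : Set MD) : Prop :=
  ∀ (M : FSKdModel.{u}) (w : M.World), (∀ φ ∈ Γ, M.Pos φ w) → ∃ ψ ∈ Δ, M.Pos ψ w

/-! ## The first-order language -/

/-- Individual variables; `n` stands for `v_n`. -/
abbrev Ind : Type := ℕ

/-- Predicate letters, indexed by their arity: unary `p_0, p_1, …`, `S` and `O`, binary `E`,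
ternary `R`. -/
inductive PredSym : ℕ → Type
  | p : ℕ → PredSym 1
  | S : PredSym 1
  | O : PredSym 1
  | E : PredSym 2
  | R : PredSym 3

/-- First-order formulas with equality. -/
inductive FO : Type
  | eq : Ind → Ind → FO
  | rel : {n : ℕ} → PredSym n → (Fin n → Ind) → FO
  | and : FO → FO → FO
  | or : FO → FO → FO
  | imp : FO → FO → FO
  | neg : FO → FO
  | all : Ind → FO → FO
  | ex : Ind → FO → FO

namespace FO

/-- `φ ↔ ψ`. -/
def iff (φ ψ : FO) : FO := (φ.imp ψ).and (ψ.imp φ)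

/-- Free variables. -/
def FV : FO → Finset Ind
  | eq x y => {x, y}
  | rel _ xs => Finset.univ.image xs
  | and φ ψ => φ.FV ∪ ψ.FV
  | or φ ψ => φ.FV ∪ ψ.FV
  | imp φ ψ => φ.FV ∪ ψ.FV
  | neg φ => φ.FV
  | all z φ => φ.FV.erase z
  | ex z φ => φ.FV.erase z

/-- `φ.subst x y` is `φ[x/y]`: every free occurrence of `x` is replaced by `y`. -/
def subst (x y : Ind) : FO → FO
  | eq a b => eq (if a = x then y else a) (if b = x then y else b)
  | rel P xs => rel P (fun i => if xs i = x then y else xs i)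
  | and φ ψ => and (φ.subst x y) (ψ.subst x y)
  | or φ ψ => or (φ.subst x y) (ψ.subst x y)
  | imp φ ψ => imp (φ.subst x y) (ψ.subst x y)
  | neg φ => neg (φ.subst x y)
  | all z φ => if z = x then all z φ else all z (φ.subst x y)
  | ex z φ => if z = x then ex z φ else ex z (φ.subst x y)

/-- `φ.Substitutable x y`: the variable `y` is substitutable for `x` in `φ`. -/
def Substitutable (x y : Ind) : FO → Prop
  | eq _ _ => True
  | rel _ _ => True
  | and φ ψ => φ.Substitutable x y ∧ ψ.Substitutable x y
  | or φ ψ => φ.Substitutable x y ∧ ψ.Substitutable x y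
  | imp φ ψ => φ.Substitutable x y ∧ ψ.Substitutable x y
  | neg φ => φ.Substitutable x y
  | all z φ => x ∈ (all z φ).FV → z ≠ y ∧ φ.Substitutable x y
  | ex z φ => x ∈ (ex z φ).FV → z ≠ y ∧ φ.Substitutable x y

/-- `bigOr θ [θ₁, …, θₛ]` is `θ ∨ θ₁ ∨ … ∨ θₛ`. -/
def bigOr : FO → List FO → FO
  | θ, [] => θ
  | θ, θ' :: l => or θ (bigOr θ' l)

end FO

/-! ## The logic `QN4` -/

open FO in
/-- Axioms of the Hilbert system for `QN4`: positive propositional logic, quantifiers, equality,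
and strong negation. -/
inductive QN4Axiom : FO → Prop
  | a1 (φ ψ) : QN4Axiom (imp φ (imp ψ φ))
  | a2 (φ ψ χ) : QN4Axiom (imp (imp φ (imp ψ χ)) (imp (imp φ ψ) (imp φ χ)))
  | a3 (φ ψ) : QN4Axiom (imp (and φ ψ) φ)
  | a4 (φ ψ) : QN4Axiom (imp (and φ ψ) ψ)
  | a5 (φ ψ) : QN4Axiom (imp φ (imp ψ (and φ ψ)))
  | a6 (φ ψ) : QN4Axiom (imp φ (or φ ψ))
  | a7 (φ ψ) : QN4Axiom (imp ψ (or φ ψ))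
  | a8 (φ ψ χ) : QN4Axiom (imp (imp φ χ) (imp (imp ψ χ) (imp (or φ ψ) χ)))
  | a9 (x y φ) : Substitutable x y φ → QN4Axiom (imp (all x φ) (subst x y φ))
  | a10 (x y φ) : Substitutable x y φ → QN4Axiom (imp (subst x y φ) (ex x φ))
  | a11 (x) : QN4Axiom (eq x x)
  | a12 (x y z φ) : Substitutable x y φ → Substitutable x z φ →
      QN4Axiom (imp (eq y z) (imp (subst x y φ) (subst x z φ)))
  | n1 (φ) : QN4Axiom (iff (neg (neg φ)) φ)
  | n2 (φ ψ) : QN4Axiom (iff (neg (and φ ψ)) (or (neg φ) (neg ψ)))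
  | n3 (φ ψ) : QN4Axiom (iff (neg (or φ ψ)) (and (neg φ) (neg ψ)))
  | n4 (φ ψ) : QN4Axiom (iff (neg (imp φ ψ)) (and φ (neg ψ)))
  | n5 (x θ) : QN4Axiom (iff (neg (ex x θ)) (all x (neg θ)))
  | n6 (x θ) : QN4Axiom (iff (neg (all x θ)) (ex x (neg θ)))

open FO in
/-- Theorems of the Hilbert system for `QN4`, with modus ponens and the two quantifier rules; the
eigenvariable `y` must not be free in the conclusion of the rule. -/
inductive QN4Provable : FO → Prop
  | ax {φ} : QN4Axiom φ → QN4Provable φ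
  | mp {φ ψ} : QN4Provable φ → QN4Provable (imp φ ψ) → QN4Provable ψ
  | rall {x y φ ψ} : Substitutable x y φ → y ∉ ψ.FV → y ∉ (all x φ).FV →
      QN4Provable (imp ψ (subst x y φ)) → QN4Provable (imp ψ (all x φ))
  | rex {x y φ ψ} : Substitutable x y φ → y ∉ ψ.FV → y ∉ (ex x φ).FV →
      QN4Provable (imp (subst x y φ) ψ) → QN4Provable (imp (ex x φ) ψ)

/-- Deductions from the premises `Γ`: members of `Γ` and theorems, closed under modus ponens. -/
inductive QN4Deducible (Γ : Set FO) : FO → Prop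
  | prem {φ} : φ ∈ Γ → QN4Deducible Γ φ
  | thm {φ} : QN4Provable φ → QN4Deducible Γ φ
  | mp {φ ψ} : QN4Deducible Γ φ → QN4Deducible Γ (FO.imp φ ψ) → QN4Deducible Γ ψ

/-- `Γ ⊨ Δ` in `QN4`: a disjunction of one or more members of `Δ` is deducible from `Γ`. -/
def QN4Entails (Γ Δ : Set FO) : Prop :=
  ∃ (θ : FO) (l : List FO), (∀ χ ∈ θ :: l, χ ∈ Δ) ∧ QN4Deducible Γ (FO.bigOr θ l)

/-! ## The modal standard translation -/

/-- The modal standard `x`-translation; `next x` is the variable fixed for the quantifier that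
translates a box evaluated at `x`. -/
def stdTrans (next : Ind → Ind) : MD → Ind → FO
  | .atom n, x => .rel (.p n) ![x]
  | .and φ ψ, x => .and (stdTrans next φ x) (stdTrans next ψ x)
  | .or φ ψ, x => .or (stdTrans next φ x) (stdTrans next ψ x)
  | .imp φ ψ, x => .imp (stdTrans next φ x) (stdTrans next ψ x)
  | .neg φ, x => .neg (stdTrans next φ x)
  | .box φ, x => .all (next x) (.imp (.rel .E ![x, next x]) (stdTrans next φ (next x)))

end NelsonModal

-- Both directions compare models. Suppose the modal consequence fails at a world of `M`. Then `M`
-- is unravelled into a Kripke model of `QN4`: an index is a tree of accessibility paths labelled by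
-- worlds, individuals are nodes, `E` is the child relation, and a larger index has more nodes and
-- larger labels. A translation holds at a node iff the modal formula holds at its label
-- (`FSKdModel.unravel_stdTrans`). This needs every world above the label of a node to become its
-- label in some larger tree: (c2) carries the increase back to the root, (c1) spreads it to all
-- other branches. Trees are saturated, so all successors of a label occur at children. Soundness
-- (`QN4Model.exists_pos_of_entails`) then refutes the `QN4` consequence.
--
-- Conversely, the modal formulas with provable translations form a logic with the laws that a
-- canonical model needs: K for □, distribution of ◇ = ∼□∼ over ∨, and (◇φ → □ψ) → □(φ → ψ). Its
-- prime theories satisfy (c1) and (c2) by `exists_acc_of_dia_mem` and `exists_le_acc`, and truth is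
-- membership (`canonicalModel_truth`). As modal deductions translate into `QN4`, a failing `QN4`
-- consequence leaves a prime theory containing Γ and disjoint from Δ. First-order completeness is
-- not needed.

namespace NelsonModal

/-! ## Kripke semantics of `QN4` -/

/-- Kripke models of `QN4` with increasing domains. Verification of an equality is actual
equality; all other atoms, and falsified equalities, are arbitrary persistent relations. -/
structure QN4Model where
  Index : Type u
  Carrier : Type u
  le : Index → Index → Prop
  le_refl : ∀ k, le k k
  le_trans : ∀ k l m, le k l → le l m → le k m
  dom : Index → Set Carrier
  dom_mono : ∀ k l, le k l → dom k ⊆ dom l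
  relPos : {n : ℕ} → PredSym n → Index → (Fin n → Carrier) → Prop
  relNeg : {n : ℕ} → PredSym n → Index → (Fin n → Carrier) → Prop
  eqNeg : Index → Carrier → Carrier → Prop
  relPos_mono : ∀ {n} (P : PredSym n) k l t, le k l → relPos P k t → relPos P l t
  relNeg_mono : ∀ {n} (P : PredSym n) k l t, le k l → relNeg P k t → relNeg P l t
  eqNeg_mono : ∀ k l a b, le k l → eqNeg k a b → eqNeg l a b

namespace QN4Model

mutual
/-- Verification of a first-order formula at an index under an assignment. -/
def Pos (M : QN4Model.{u}) : FO → M.Index → (Ind → M.Carrier) → Prop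
  | .eq x y, _, v => v x = v y
  | .rel P xs, k, v => M.relPos P k (fun i => v (xs i))
  | .and φ ψ, k, v => M.Pos φ k v ∧ M.Pos ψ k v
  | .or φ ψ, k, v => M.Pos φ k v ∨ M.Pos ψ k v
  | .imp φ ψ, k, v => ∀ l, M.le k l → M.Pos φ l v → M.Pos ψ l v
  | .neg φ, k, v => M.Neg φ k v
  | .all z φ, k, v => ∀ l, M.le k l → ∀ d ∈ M.dom l, M.Pos φ l (Function.update v z d)
  | .ex z φ, k, v => ∃ d ∈ M.dom k, M.Pos φ k (Function.update v z d)
/-- Falsification of a first-order formula at an index under an assignment. -/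
def Neg (M : QN4Model.{u}) : FO → M.Index → (Ind → M.Carrier) → Prop
  | .eq x y, k, v => M.eqNeg k (v x) (v y)
  | .rel P xs, k, v => M.relNeg P k (fun i => v (xs i))
  | .and φ ψ, k, v => M.Neg φ k v ∨ M.Neg ψ k v
  | .or φ ψ, k, v => M.Neg φ k v ∧ M.Neg ψ k v
  | .imp φ ψ, k, v => M.Pos φ k v ∧ M.Neg ψ k v
  | .neg φ, k, v => M.Pos φ k v
  | .all z φ, k, v => ∃ d ∈ M.dom k, M.Neg φ k (Function.update v z d)
  | .ex z φ, k, v => ∀ l, M.le k l → ∀ d ∈ M.dom l, M.Neg φ l (Function.update v z d)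
end

variable {M : QN4Model.{u}}

theorem mono (φ : FO) {k l : M.Index} (h : M.le k l) (v : Ind → M.Carrier) :
    (M.Pos φ k v → M.Pos φ l v) ∧ (M.Neg φ k v → M.Neg φ l v) := by
  induction φ generalizing v with
  | eq x y => exact ⟨id, M.eqNeg_mono _ _ _ _ h⟩
  | rel P xs => exact ⟨M.relPos_mono P _ _ _ h, M.relNeg_mono P _ _ _ h⟩
  | and φ ψ ih₁ ih₂ =>
    exact ⟨And.imp (ih₁ v).1 (ih₂ v).1, Or.imp (ih₁ v).2 (ih₂ v).2⟩
  | or φ ψ ih₁ ih₂ =>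
    exact ⟨Or.imp (ih₁ v).1 (ih₂ v).1, And.imp (ih₁ v).2 (ih₂ v).2⟩
  | imp φ ψ ih₁ ih₂ =>
    exact ⟨fun H m hm => H m (M.le_trans _ _ _ h hm), And.imp (ih₁ v).1 (ih₂ v).2⟩
  | neg φ ih => exact ⟨(ih v).2, (ih v).1⟩
  | all z φ ih =>
    exact ⟨fun H m hm => H m (M.le_trans _ _ _ h hm),
      fun ⟨d, hd, H⟩ => ⟨d, M.dom_mono _ _ h hd, (ih _).2 H⟩⟩
  | ex z φ ih =>
    exact ⟨fun ⟨d, hd, H⟩ => ⟨d, M.dom_mono _ _ h hd, (ih _).1 H⟩,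
      fun H m hm => H m (M.le_trans _ _ _ h hm)⟩

theorem congr_FV (φ : FO) (k : M.Index) {v v' : Ind → M.Carrier} (h : ∀ i ∈ φ.FV, v i = v' i) :
    (M.Pos φ k v ↔ M.Pos φ k v') ∧ (M.Neg φ k v ↔ M.Neg φ k v') := by
  have upd : ∀ {z : Ind} {φ : FO} {v v' : Ind → M.Carrier} (d : M.Carrier),
      (∀ i ∈ φ.FV.erase z, v i = v' i) →
      ∀ i ∈ φ.FV, Function.update v z d i = Function.update v' z d i := by
    intro z φ v v' d h i hi
    by_cases hz : i = z
    · subst hz; simp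
    · simp [hz, h i (Finset.mem_erase.2 ⟨hz, hi⟩)]
  induction φ generalizing k v v' with
  | eq x y =>
    have hx := h x (by simp [FO.FV])
    have hy := h y (by simp [FO.FV])
    simp [Pos, Neg, hx, hy]
  | rel P xs =>
    have : (fun i => v (xs i)) = fun i => v' (xs i) :=
      funext fun i => h _ (by simp [FO.FV])
    simp [Pos, Neg, this]
  | and φ ψ ih₁ ih₂ | or φ ψ ih₁ ih₂ | imp φ ψ ih₁ ih₂ =>
    have h₁ := fun k => ih₁ k (fun i hi => h i (Finset.mem_union_left _ hi))
    have h₂ := fun k => ih₂ k (fun i hi => h i (Finset.mem_union_right _ hi))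
    simp [Pos, Neg, h₁, h₂]
  | neg φ ih =>
    have h₁ := ih k h
    simp [Pos, Neg, h₁]
  | all z φ ih | ex z φ ih =>
    have h₁ := fun k d => ih k (upd d h)
    simp [Pos, Neg, h₁]

end QN4Model

theorem FO.subst_of_notMem_FV (φ : FO) {x y : Ind} (h : x ∉ φ.FV) : φ.subst x y = φ := by
  induction φ with
  | eq a b =>
    simp only [FO.FV, Finset.mem_insert, Finset.mem_singleton, not_or] at h
    simp [FO.subst, Ne.symm h.1, Ne.symm h.2]
  | rel P xs =>
    simp only [FO.FV, Finset.mem_image, Finset.mem_univ, true_and, not_exists] at h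
    simp [FO.subst, h]
  | and φ ψ ih₁ ih₂ | or φ ψ ih₁ ih₂ | imp φ ψ ih₁ ih₂ =>
    simp only [FO.FV, Finset.mem_union, not_or] at h
    simp [FO.subst, ih₁ h.1, ih₂ h.2]
  | neg φ ih => simp [FO.subst, ih h]
  | all z φ ih | ex z φ ih =>
    by_cases hz : z = x
    · simp [FO.subst, hz]
    · simp only [FO.FV, Finset.mem_erase, not_and] at h
      simp [FO.subst, hz, ih (h (Ne.symm hz))]

namespace QN4Model

variable {M : QN4Model.{u}}

theorem subst_iff (φ : FO) {x y : Ind} (h : φ.Substitutable x y) (k : M.Index)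
    (v : Ind → M.Carrier) :
    (M.Pos (φ.subst x y) k v ↔ M.Pos φ k (Function.update v x (v y))) ∧
      (M.Neg (φ.subst x y) k v ↔ M.Neg φ k (Function.update v x (v y))) := by
  have key : ∀ a, v (if a = x then y else a) = Function.update v x (v y) a := by
    intro a
    by_cases ha : a = x
    · subst ha; simp
    · simp [ha]
  induction φ generalizing k v with
  | eq a b => simp only [FO.subst, Pos, Neg, key, and_self]
  | rel P xs => simp only [FO.subst, Pos, Neg, key, and_self]
  | and φ ψ ih₁ ih₂ | or φ ψ ih₁ ih₂ | imp φ ψ ih₁ ih₂ =>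
    have h₁ := fun k => ih₁ h.1 k v key
    have h₂ := fun k => ih₂ h.2 k v key
    simp [FO.subst, Pos, Neg, h₁, h₂]
  | neg φ ih =>
    have h₁ := ih h k v key
    simp [FO.subst, Pos, Neg, h₁]
  | all z φ ih | ex z φ ih =>
    by_cases hx : x ∈ φ.FV.erase z
    · obtain ⟨hzy, hs⟩ := h hx
      have hzx : z ≠ x := fun e => (Finset.mem_erase.1 hx).1 e.symm
      have h₁ : ∀ k d, _ := fun k d => ih hs k (Function.update v z d) (by
        intro a
        by_cases ha : a = x
        · subst ha; simp
        · simp [ha])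
      have h₂ : ∀ d, Function.update (Function.update v z d) x (Function.update v z d y) =
          Function.update (Function.update v x (v y)) z d := by
        intro d
        rw [Function.update_of_ne (Ne.symm hzy), Function.update_comm hzx.symm]
      simp only [h₂] at h₁
      simp [FO.subst, hzx, Pos, Neg, h₁]
    -- `Substitutable` says nothing about the body here, but `x` is not free in the quantified
    -- formula, so the substitution and the update at `x` are both vacuous.
    · rw [FO.subst_of_notMem_FV _ hx]
      refine congr_FV _ k fun i hi => ?_
      rw [Function.update_of_ne]
      rintro rfl
      exact hx hi

-- Soundness of the Hilbert system

theorem pos_of_axiom {φ : FO} (hφ : QN4Axiom φ) (k : M.Index) (v : Ind → M.Carrier)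
    (hv : ∀ i, v i ∈ M.dom k) : M.Pos φ k v := by
  have tr := @M.le_trans
  have mn : ∀ (φ : FO) {k l : M.Index} {v}, M.le k l → M.Pos φ k v → M.Pos φ l v :=
    fun φ _ _ v h => (mono φ h v).1
  have rf := M.le_refl
  cases hφ with
  | a1 φ ψ => exact fun l _ h m hm _ => mn φ hm h
  | a2 φ ψ χ =>
    exact fun l _ h m hm h' n hn h'' => h n (tr _ _ _ hm hn) h'' n (rf n) (h' n hn h'')
  | a3 φ ψ => exact fun l _ h => h.1
  | a4 φ ψ => exact fun l _ h => h.2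
  | a5 φ ψ => exact fun l _ h m hm h' => ⟨mn φ hm h, h'⟩
  | a6 φ ψ => exact fun l _ h => Or.inl h
  | a7 φ ψ => exact fun l _ h => Or.inr h
  | a8 φ ψ χ =>
    exact fun l _ h m hm h' n hn h'' =>
      h''.elim (h n (tr _ _ _ hm hn)) (h' n hn)
  | a9 x y φ hs =>
    exact fun l hl h => (subst_iff φ hs l v).1.2 (h l (rf l) _ (M.dom_mono _ _ hl (hv y)))
  | a10 x y φ hs =>
    exact fun l hl h => ⟨v y, M.dom_mono _ _ hl (hv y), (subst_iff φ hs l v).1.1 h⟩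
  | a11 x => exact (rfl : v x = v x)
  | a12 x y z φ hy hz =>
    intro l _ (h : v y = v z) m _ h'
    rw [(subst_iff φ hz m v).1, ← h]
    exact (subst_iff φ hy m v).1.1 h'
  -- The two sides of each strong negation axiom unfold to the same clause.
  | n1 φ | n2 φ ψ | n3 φ ψ | n4 φ ψ | n5 x θ | n6 x θ =>
    exact ⟨fun _ _ h => h, fun _ _ h => h⟩

/-- For the quantifier rules, the premise is used at the assignment sending the eigenvariable `y` to
the given individual: `ψ` does not see this change, and `φ[x/y]` becomes `φ` with `x` sent there.
Freshness is only required for the quantified formula, so `y = x` is allowed. -/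
theorem pos_of_provable {φ : FO} (hφ : QN4Provable φ) (k : M.Index) (v : Ind → M.Carrier)
    (hv : ∀ i, v i ∈ M.dom k) : M.Pos φ k v := by
  have upd : ∀ {k : M.Index} {v : Ind → M.Carrier} {y d}, (∀ i, v i ∈ M.dom k) → d ∈ M.dom k →
      ∀ i, Function.update v y d i ∈ M.dom k := by
    intro k v y d hv hd i
    by_cases hi : i = y
    · subst hi; simpa
    · simpa [hi] using hv i
  have ups : ∀ {φ : FO} {x y : Ind} {v : Ind → M.Carrier} {d}, y ∉ φ.FV.erase x →
      ∀ i ∈ φ.FV, Function.update (Function.update v y d) x (Function.update v y d y) i =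
        Function.update v x d i := by
    intro φ x y v d hy i hi
    by_cases hx : i = x
    · subst hx; simp
    · have : i ≠ y := by rintro rfl; exact hy (Finset.mem_erase.2 ⟨hx, hi⟩)
      simp [hx, this]
  have upn : ∀ {ψ : FO} {y : Ind} {v : Ind → M.Carrier} {d}, y ∉ ψ.FV →
      ∀ i ∈ ψ.FV, Function.update v y d i = v i := by
    intro ψ y v d hy i hi
    rw [Function.update_of_ne]
    rintro rfl
    exact hy hi
  induction hφ generalizing k v with
  | ax h => exact pos_of_axiom h k v hv
  | mp _ _ ih₁ ih₂ => exact ih₂ k v hv k (M.le_refl k) (ih₁ k v hv)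
  | @rall x y φ ψ hs hψ hφ _ ih =>
    intro l hl h m hm d hd
    have hv' := upd (y := y) (fun i => M.dom_mono _ _ (M.le_trans _ _ _ hl hm) (hv i)) hd
    have h₁ := ih m _ hv' m (M.le_refl m) ((congr_FV ψ m (upn hψ)).1.2 ((mono ψ hm v).1 h))
    exact (congr_FV φ m (ups hφ)).1.1 ((subst_iff φ hs m _).1.1 h₁)
  | @rex x y φ ψ hs hψ hφ _ ih =>
    rintro l hl ⟨d, hd, h⟩
    have hv' := upd (y := y) (fun i => M.dom_mono _ _ hl (hv i)) hd
    have h₁ := ih l _ hv' l (M.le_refl l)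
      ((subst_iff φ hs l _).1.2 ((congr_FV φ l (ups hφ)).1.2 h))
    exact (congr_FV ψ l (upn hψ)).1.1 h₁

theorem pos_of_deducible {Γ : Set FO} {φ : FO} (hφ : QN4Deducible Γ φ) (k : M.Index)
    (v : Ind → M.Carrier) (hv : ∀ i, v i ∈ M.dom k) (hΓ : ∀ γ ∈ Γ, M.Pos γ k v) :
    M.Pos φ k v := by
  induction hφ with
  | prem h => exact hΓ _ h
  | thm h => exact pos_of_provable h k v hv
  | mp _ _ ih₁ ih₂ => exact ih₂ k (M.le_refl k) ih₁

theorem exists_pos_of_bigOr (θ : FO) (l : List FO) {k : M.Index} {v : Ind → M.Carrier}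
    (h : M.Pos (FO.bigOr θ l) k v) : ∃ χ ∈ θ :: l, M.Pos χ k v := by
  induction l generalizing θ with
  | nil => exact ⟨θ, by simp, h⟩
  | cons θ' l ih =>
    rcases h with h | h
    · exact ⟨θ, by simp, h⟩
    · obtain ⟨χ, hχ, h⟩ := ih θ' h
      exact ⟨χ, List.mem_cons_of_mem _ hχ, h⟩

/-- Soundness of `QN4` for Kripke models. -/
theorem exists_pos_of_entails {Γ Δ : Set FO} (h : QN4Entails Γ Δ) (k : M.Index)
    (v : Ind → M.Carrier) (hv : ∀ i, v i ∈ M.dom k) (hΓ : ∀ γ ∈ Γ, M.Pos γ k v) :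
    ∃ δ ∈ Δ, M.Pos δ k v := by
  obtain ⟨θ, l, hl, hd⟩ := h
  obtain ⟨χ, hχ, H⟩ := exists_pos_of_bigOr θ l (pos_of_deducible hd k v hv hΓ)
  exact ⟨χ, hl χ hχ, H⟩

end QN4Model

/-! ## Unravelling a birelational model into a Kripke model of `QN4` -/

namespace FSKdModel

/-- A tree of accessibility paths of `M`. Nodes are finite sequences, the root being `[]`; the
numbers occurring in them stay below `stage`, so that fresh children can always be added. -/
structure Labelling (M : FSKdModel.{u}) where
  nodes : Set (List (ℕ × M.World))
  label : List (ℕ × M.World) → M.World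
  stage : ℕ
  nil_mem : [] ∈ nodes
  tail_mem : ∀ a d, a :: d ∈ nodes → d ∈ nodes
  acc_label : ∀ a d, a :: d ∈ nodes → M.acc (label d) (label (a :: d))
  lt_stage : ∀ a d, a :: d ∈ nodes → a.1 < stage

-- Saturating a tree and raising its labels

namespace Labelling

variable {M : FSKdModel.{u}}

/-- Every successor of the label of a node labels a child of this node. -/
def Saturated (L : M.Labelling) : Prop :=
  ∀ d ∈ L.nodes, ∀ t, M.acc (L.label d) t → ∃ a, a :: d ∈ L.nodes ∧ L.label (a :: d) = t

/-- The order of labellings: more nodes, and larger labels. -/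
def Le (L L' : M.Labelling) : Prop :=
  ∀ d ∈ L.nodes, d ∈ L'.nodes ∧ M.le (L.label d) (L'.label d)

theorem Le.refl (L : M.Labelling) : L.Le L := fun _ h => ⟨h, M.le_refl _⟩

theorem Le.trans {L L' L'' : M.Labelling} (h : L.Le L') (h' : L'.Le L'') : L.Le L'' :=
  fun d hd => ⟨(h' d (h d hd).1).1, M.le_trans _ _ _ (h d hd).2 (h' d (h d hd).1).2⟩

/-- The labels of the saturation: fresh children carry their label in their name. -/
def satLabel (L : M.Labelling) : List (ℕ × M.World) → M.World
  | [] => L.label []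
  | a :: d => if a.1 = L.stage then a.2 else L.label (a :: d)

/-- The nodes of the saturation. -/
def satNodes (L : M.Labelling) : List (ℕ × M.World) → Prop
  | [] => True
  | a :: d => (a.1 = L.stage ∧ L.satNodes d ∧ M.acc (L.satLabel d) a.2) ∨ a :: d ∈ L.nodes

theorem satNodes_of_mem (L : M.Labelling) {d} (h : d ∈ L.nodes) : L.satNodes d := by
  cases d with
  | nil => trivial
  | cons a d => exact Or.inr h

theorem satLabel_of_mem (L : M.Labelling) {d} (h : d ∈ L.nodes) : L.satLabel d = L.label d := by
  cases d with
  | nil => rfl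
  | cons a d => simp [satLabel, (L.lt_stage a d h).ne]

/-- One pass suffices, because fresh children receive fresh children by recursion along the path. A
fresh child is named by the current `stage` and its own label, so `lt_stage` keeps it apart from the
old nodes. -/
theorem exists_saturated (L : M.Labelling) :
    ∃ L' : M.Labelling, L'.Saturated ∧ ∀ d ∈ L.nodes, d ∈ L'.nodes ∧ L'.label d = L.label d := by
  refine ⟨⟨{d | L.satNodes d}, L.satLabel, L.stage + 1, trivial, ?_, ?_, ?_⟩, ?_, ?_⟩
  · rintro a d (⟨-, h, -⟩ | h)
    · exact h
    · exact L.satNodes_of_mem (L.tail_mem _ _ h)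
  · rintro a d (⟨h₁, -, h₂⟩ | h)
    · simpa [satLabel, h₁] using h₂
    · rw [L.satLabel_of_mem h, L.satLabel_of_mem (L.tail_mem _ _ h)]
      exact L.acc_label _ _ h
  · rintro a d (⟨h, -⟩ | h)
    · exact h ▸ Nat.lt_succ_self _
    · exact (L.lt_stage _ _ h).trans (Nat.lt_succ_self _)
  · intro d hd t ht
    exact ⟨(L.stage, t), Or.inl ⟨rfl, hd, ht⟩, by simp [satLabel]⟩
  · exact fun d hd => ⟨L.satNodes_of_mem hd, L.satLabel_of_mem hd⟩

/-- `g` is an admissible increase of the labels of `L`. -/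
def Raises (L : M.Labelling) (g : List (ℕ × M.World) → M.World) : Prop :=
  (∀ d ∈ L.nodes, M.le (L.label d) (g d)) ∧ ∀ a d, a :: d ∈ L.nodes → M.acc (g d) (g (a :: d))

open Classical in
/-- Labels can be increased from the root downwards, following prescribed labels `p` wherever these
are admissible. -/
theorem exists_raises (L : M.Labelling) (p : List (ℕ × M.World) → M.World)
    (hp : M.le (L.label []) (p [])) :
    ∃ g, L.Raises g ∧ g [] = p [] ∧ ∀ a d, M.acc (g d) (p (a :: d)) →
      M.le (L.label (a :: d)) (p (a :: d)) → g (a :: d) = p (a :: d) := by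
  -- The prescribed label is taken if admissible, otherwise any label supplied by (c1). The final
  -- default `w` is never reached at a node.
  let step (a : ℕ × M.World) (d : List (ℕ × M.World)) (w : M.World) : M.World :=
    if M.acc w (p (a :: d)) ∧ M.le (L.label (a :: d)) (p (a :: d)) then p (a :: d)
    else if h : ∃ t, M.acc w t ∧ M.le (L.label (a :: d)) t then h.choose else w
  let g : List (ℕ × M.World) → M.World := fun d => List.rec (p []) (fun a d w => step a d w) d
  have hstep : ∀ a d, a :: d ∈ L.nodes → M.le (L.label d) (g d) →
      M.acc (g d) (g (a :: d)) ∧ M.le (L.label (a :: d)) (g (a :: d)) := by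
    intro a d had hd
    change M.acc (g d) (step a d (g d)) ∧ M.le (L.label (a :: d)) (step a d (g d))
    by_cases h₁ : M.acc (g d) (p (a :: d)) ∧ M.le (L.label (a :: d)) (p (a :: d))
    · simpa only [step, if_pos h₁] using h₁
    · have h₂ : ∃ t, M.acc (g d) t ∧ M.le (L.label (a :: d)) t :=
        M.acc_forth _ _ _ hd (L.acc_label a d had)
      simpa only [step, if_neg h₁, dif_pos h₂] using h₂.choose_spec
  have hle : ∀ d ∈ L.nodes, M.le (L.label d) (g d) := by
    intro d
    induction d with
    | nil => exact fun _ => hp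
    | cons a d ih => exact fun h => (hstep a d h (ih (L.tail_mem _ _ h))).2
  exact ⟨g, ⟨hle, fun a d h => (hstep a d h (hle d (L.tail_mem _ _ h))).1⟩, rfl,
    fun a d h₁ h₂ => if_pos ⟨h₁, h₂⟩⟩

/-- Induction along the path to the root: (c2) gives a larger label for the parent that accesses
`w`, and the induction hypothesis raises the tree accordingly. The labels are then recomputed from
the root with `w` prescribed at the node itself. -/
theorem exists_raises_eq (L : M.Labelling) {d} (hd : d ∈ L.nodes) {w : M.World}
    (hw : M.le (L.label d) w) : ∃ g, L.Raises g ∧ g d = w := by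
  classical
  induction d generalizing w with
  | nil =>
    obtain ⟨g, hg, h, -⟩ := L.exists_raises (fun _ => w) hw
    exact ⟨g, hg, h⟩
  | cons a d ih =>
    have hd' := L.tail_mem _ _ hd
    obtain ⟨w', hw', hacc⟩ := M.acc_back _ _ _ (L.acc_label a d hd) hw
    obtain ⟨g, hg, hgd⟩ := ih hd' hw'
    obtain ⟨g', hg', hnil, hcons⟩ := L.exists_raises (Function.update g (a :: d) w)
      (by simpa using hg.1 _ L.nil_mem)
    -- Nodes no longer than the parent are unaffected by the new prescription, and `g` is admissible
    -- on them; so the parent keeps the label that accesses `w`.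
    have hagree : ∀ e ∈ L.nodes, e.length ≤ d.length → g' e = g e := by
      intro e
      induction e with
      | nil => intro _ _; simpa using hnil
      | cons b e ihe =>
        intro he hlen
        have hne : b :: e ≠ a :: d := by
          intro h
          rw [h] at hlen
          simp at hlen
        have := hcons b e
        rw [Function.update_of_ne hne, ihe (L.tail_mem _ _ he) (Nat.le_of_succ_le hlen)] at this
        exact this (hg.2 b e he) (hg.1 _ he)
    refine ⟨g', hg', ?_⟩
    have := hcons a d
    rw [Function.update_self, hagree d hd' le_rfl, hgd] at this
    exact this hacc hw

/-- Matches the modal quantification over worlds above a label with the first-order quantification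
over larger indices, the node staying fixed. -/
theorem exists_saturated_le_label_eq (L : M.Labelling) {d} (hd : d ∈ L.nodes) {w : M.World}
    (hw : M.le (L.label d) w) :
    ∃ L' : M.Labelling, L'.Saturated ∧ L.Le L' ∧ L'.label d = w := by
  obtain ⟨g, hg, hgd⟩ := L.exists_raises_eq hd hw
  obtain ⟨L', hs, h⟩ := exists_saturated
    ⟨L.nodes, g, L.stage, L.nil_mem, L.tail_mem, hg.2, L.lt_stage⟩
  refine ⟨L', hs, fun e he => ⟨(h e he).1, ?_⟩, (h d hd).2.trans hgd⟩
  rw [(h e he).2]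
  exact hg.1 e he

theorem exists_saturated_root (w : M.World) :
    ∃ L : M.Labelling, L.Saturated ∧ L.label [] = w := by
  obtain ⟨L, hs, h⟩ := exists_saturated (M := M)
    ⟨{[]}, fun _ => w, 0, rfl, by simp, by simp, by simp⟩
  exact ⟨L, hs, (h [] rfl).2⟩

end Labelling

/-- Verified atoms of the unravelling. -/
def unravelPos (M : FSKdModel.{u}) (L : M.Labelling) :
    {n : ℕ} → PredSym n → (Fin n → List (ℕ × M.World)) → Prop
  | _, .p n, t => t 0 ∈ L.nodes ∧ L.label (t 0) ∈ M.valPos n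
  | _, .S, _ => False
  | _, .O, _ => False
  | _, .E, t => ∃ a, t 1 = a :: t 0 ∧ t 1 ∈ L.nodes
  | _, .R, _ => False

/-- Falsified atoms of the unravelling. -/
def unravelNeg (M : FSKdModel.{u}) (L : M.Labelling) :
    {n : ℕ} → PredSym n → (Fin n → List (ℕ × M.World)) → Prop
  | _, .p n, t => t 0 ∈ L.nodes ∧ L.label (t 0) ∈ M.valNeg n
  | _, .S, _ => False
  | _, .O, _ => False
  | _, .E, _ => False
  | _, .R, _ => False

/-- The Kripke model of saturated labellings. -/
def unravel (M : FSKdModel.{u}) : QN4Model.{u} where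
  Index := {L : M.Labelling // L.Saturated}
  Carrier := List (ℕ × M.World)
  le L L' := L.1.Le L'.1
  le_refl _ := .refl _
  le_trans _ _ _ := .trans
  dom L := L.1.nodes
  dom_mono _ _ h _ hd := (h _ hd).1
  relPos P L t := M.unravelPos L.1 P t
  relNeg P L t := M.unravelNeg L.1 P t
  eqNeg _ _ _ := False
  relPos_mono P L L' t h hP := by
    cases P with
    | p n => exact ⟨(h _ hP.1).1, M.valPos_mono _ _ _ (h _ hP.1).2 hP.2⟩
    | E => exact ⟨hP.choose, hP.choose_spec.1, (h _ hP.choose_spec.2).1⟩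
    | S | O | R => exact hP
  relNeg_mono P L L' t h hP := by
    cases P with
    | p n => exact ⟨(h _ hP.1).1, M.valNeg_mono _ _ _ (h _ hP.1).2 hP.2⟩
    | S | O | R | E => exact hP
  eqNeg_mono _ _ _ _ _ h := h

/-- The standard translation holds at a node of the unravelling iff the modal formula holds at the
label of this node. -/
theorem unravel_stdTrans (M : FSKdModel.{u}) {next : Ind → Ind} (hnext : ∀ x, next x ≠ x) (φ : MD)
    (x : Ind) (L : M.unravel.Index) (v : Ind → List (ℕ × M.World)) (hv : v x ∈ L.1.nodes) :
    (M.unravel.Pos (stdTrans next φ x) L v ↔ M.Pos φ (L.1.label (v x))) ∧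
      (M.unravel.Neg (stdTrans next φ x) L v ↔ M.Neg φ (L.1.label (v x))) := by
  induction φ generalizing x L v with
  | atom n => exact ⟨and_iff_right hv, and_iff_right hv⟩
  | and φ ψ ih₁ ih₂ =>
    exact ⟨and_congr (ih₁ x L v hv).1 (ih₂ x L v hv).1, or_congr (ih₁ x L v hv).2 (ih₂ x L v hv).2⟩
  | or φ ψ ih₁ ih₂ =>
    exact ⟨or_congr (ih₁ x L v hv).1 (ih₂ x L v hv).1, and_congr (ih₁ x L v hv).2 (ih₂ x L v hv).2⟩
  | imp φ ψ ih₁ ih₂ =>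
    refine ⟨⟨fun H w hw hφ => ?_, fun H L' hL hφ => ?_⟩,
      and_congr (ih₁ x L v hv).1 (ih₂ x L v hv).2⟩
    · obtain ⟨L', hs, hle, rfl⟩ := L.1.exists_saturated_le_label_eq hv hw
      have hv' := (hle _ hv).1
      exact (ih₂ x ⟨L', hs⟩ v hv').1.1 (H ⟨L', hs⟩ hle ((ih₁ x ⟨L', hs⟩ v hv').1.2 hφ))
    · have hv' := (hL _ hv).1
      exact (ih₂ x L' v hv').1.2 (H _ (hL _ hv).2 ((ih₁ x L' v hv').1.1 hφ))
  | neg φ ih => exact ⟨(ih x L v hv).2, (ih x L v hv).1⟩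
  | box φ ih =>
    have hE : ∀ (L : M.unravel.Index) (d : List (ℕ × M.World)),
        M.unravel.Pos (.rel .E ![x, next x]) L (Function.update v (next x) d) ↔
          ∃ a, d = a :: v x ∧ d ∈ L.1.nodes := by
      intro L d
      change (∃ a, Function.update v (next x) d (next x) =
        a :: Function.update v (next x) d x ∧ Function.update v (next x) d (next x) ∈ _) ↔ _
      rw [Function.update_self, Function.update_of_ne (hnext x).symm]
    have ih' : ∀ (L : M.unravel.Index) (d : List (ℕ × M.World)), d ∈ L.1.nodes → _ := fun L d hd =>
      ih (next x) L (Function.update v (next x) d) (by rwa [Function.update_self])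
    simp only [Function.update_self] at ih'
    refine ⟨⟨fun H w hw t ht => ?_, fun H L' hL d hd L'' hL' hd' => ?_⟩,
      ⟨fun H => ?_, fun H => ?_⟩⟩
    -- Once the label of `v x` is raised to `w`, saturation yields a child labelled `t`, which
    -- instantiates the quantifier.
    · obtain ⟨L', hs, hle, rfl⟩ := L.1.exists_saturated_le_label_eq hv hw
      obtain ⟨a, ha, rfl⟩ := hs _ (hle _ hv).1 t ht
      exact (ih' ⟨L', hs⟩ _ ha).1.1 (H ⟨L', hs⟩ hle _ ha ⟨L', hs⟩ (.refl _)
        ((hE _ _).2 ⟨a, rfl, ha⟩))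
    · obtain ⟨a, rfl, ha⟩ := (hE _ _).1 hd'
      exact (ih' L'' _ ha).1.2 (H _ ((hL.trans hL') _ hv).2 _ (L''.1.acc_label _ _ ha))
    · obtain ⟨d, hd, hd', H⟩ := H
      obtain ⟨a, rfl, ha⟩ := (hE _ _).1 hd'
      exact ⟨_, L.1.acc_label _ _ ha, (ih' L _ ha).2.1 H⟩
    · obtain ⟨t, ht, H⟩ := H
      obtain ⟨a, ha, rfl⟩ := L.2 _ hv t ht
      exact ⟨_, ha, (hE _ _).2 ⟨a, rfl, ha⟩, (ih' L _ ha).2.2 H⟩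

end FSKdModel

theorem FSKdEntails_of_QN4Entails {next : Ind → Ind} (hnext : ∀ x, next x ≠ x) {Γ Δ : Set MD}
    {x : Ind} (h : QN4Entails ((fun φ => stdTrans next φ x) '' Γ)
      ((fun φ => stdTrans next φ x) '' Δ)) : FSKdEntails.{u} Γ Δ := by
  intro M w hw
  obtain ⟨L, hs, rfl⟩ := FSKdModel.Labelling.exists_saturated_root w
  have key := fun φ => (M.unravel_stdTrans hnext φ x ⟨L, hs⟩ (fun _ => []) L.nil_mem).1
  obtain ⟨_, ⟨ψ, hψ, rfl⟩, H⟩ := QN4Model.exists_pos_of_entails (M := M.unravel) h ⟨L, hs⟩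
    (fun _ => []) (fun _ => L.nil_mem) (by rintro _ ⟨φ, hφ, rfl⟩; exact (key φ).2 (hw φ hφ))
  exact ⟨ψ, hψ, (key ψ).1 H⟩

end NelsonModal

namespace NelsonModal

/-! ## Derivations in `QN4` -/

theorem FO.subst_self (x : Ind) (φ : FO) : φ.subst x x = φ := by
  have key : ∀ a, (if a = x then x else a) = a := by
    intro a
    split_ifs with h
    · exact h.symm
    · rfl
  induction φ with
  | eq a b | rel P xs => simp only [FO.subst, key]
  | and φ ψ ih₁ ih₂ | or φ ψ ih₁ ih₂ | imp φ ψ ih₁ ih₂ => simp only [FO.subst, ih₁, ih₂]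
  | neg φ ih | all z φ ih | ex z φ ih => simp only [FO.subst, ih, ite_self]

theorem FO.substitutable_self (x : Ind) (φ : FO) : φ.Substitutable x x := by
  induction φ with
  | eq a b | rel P xs => trivial
  | and φ ψ ih₁ ih₂ | or φ ψ ih₁ ih₂ | imp φ ψ ih₁ ih₂ => exact ⟨ih₁, ih₂⟩
  | neg φ ih => exact ih
  | all z φ ih | ex z φ ih => exact fun h => ⟨(Finset.ne_of_mem_erase h).symm, ih⟩

namespace QN4Deducible

variable {Γ : Set FO} {φ ψ χ : FO}

theorem ax (h : QN4Axiom φ) : QN4Deducible Γ φ := thm (.ax h)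

theorem hyp : QN4Deducible (insert φ Γ) φ := prem (Set.mem_insert _ _)

theorem mono {Γ' : Set FO} (h : QN4Deducible Γ φ) (hΓ : Γ ⊆ Γ') : QN4Deducible Γ' φ := by
  induction h with
  | prem h => exact prem (hΓ h)
  | thm h => exact thm h
  | mp _ _ ih₁ ih₂ => exact mp ih₁ ih₂

theorem weaken (h : QN4Deducible Γ φ) : QN4Deducible (insert ψ Γ) φ :=
  h.mono (Set.subset_insert _ _)

/-- The deduction theorem. -/
theorem deduction (h : QN4Deducible (insert φ Γ) ψ) : QN4Deducible Γ (φ.imp ψ) := by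
  induction h with
  | @prem χ h =>
    rcases h with rfl | h
    · exact mp (ax (.a1 χ χ)) (mp (ax (.a1 χ (χ.imp χ))) (ax (.a2 _ _ _)))
    · exact mp (prem h) (ax (.a1 _ _))
  | thm h => exact mp (thm h) (ax (.a1 _ _))
  | mp _ _ ih₁ ih₂ => exact mp ih₁ (mp ih₂ (ax (.a2 _ _ _)))

theorem provable (h : QN4Deducible ∅ φ) : QN4Provable φ := by
  induction h with
  | prem h => exact h.elim
  | thm h => exact h
  | mp _ _ ih₁ ih₂ => exact .mp ih₁ ih₂

theorem and_intro (h₁ : QN4Deducible Γ φ) (h₂ : QN4Deducible Γ ψ) : QN4Deducible Γ (φ.and ψ) :=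
  mp h₂ (mp h₁ (ax (.a5 _ _)))

theorem and_left (h : QN4Deducible Γ (φ.and ψ)) : QN4Deducible Γ φ := mp h (ax (.a3 _ _))

theorem and_right (h : QN4Deducible Γ (φ.and ψ)) : QN4Deducible Γ ψ := mp h (ax (.a4 _ _))

theorem or_elim (h : QN4Deducible Γ (φ.or ψ)) (h₁ : QN4Deducible (insert φ Γ) χ)
    (h₂ : QN4Deducible (insert ψ Γ) χ) : QN4Deducible Γ χ :=
  mp h (mp h₂.deduction (mp h₁.deduction (ax (.a8 _ _ _))))

theorem iff_mp (h : QN4Axiom (φ.iff ψ)) (hφ : QN4Deducible Γ φ) : QN4Deducible Γ ψ :=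
  mp hφ (and_left (ax h))

theorem iff_mpr (h : QN4Axiom (φ.iff ψ)) (hψ : QN4Deducible Γ ψ) : QN4Deducible Γ φ :=
  mp hψ (and_right (ax h))

theorem all_elim {y : Ind} (h : QN4Deducible Γ (.all y φ)) : QN4Deducible Γ φ := by
  have := QN4Axiom.a9 y y φ (FO.substitutable_self y φ)
  rw [FO.subst_self] at this
  exact mp h (ax this)

theorem ex_intro {y : Ind} (h : QN4Deducible Γ φ) : QN4Deducible Γ (.ex y φ) := by
  have := QN4Axiom.a10 y y φ (FO.substitutable_self y φ)
  rw [FO.subst_self] at this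
  exact mp h (ax this)

/-- Introduction of a falsified bounded universal quantifier. -/
theorem neg_all_intro {y : Ind} (h₁ : QN4Deducible Γ φ) (h₂ : QN4Deducible Γ ψ.neg) :
    QN4Deducible Γ (FO.all y (φ.imp ψ)).neg :=
  iff_mpr (.n6 _ _) (ex_intro (iff_mpr (.n4 _ _) (and_intro h₁ h₂)))

end QN4Deducible

-- Laws of bounded quantification behind □ and ◇

namespace QN4Provable

open QN4Deducible

variable {φ ψ ε α β : FO} {y : Ind}

/-- The bound variable serves as its own eigenvariable, since it is not free in the quantified
formula. -/
theorem imp_all (h : QN4Deducible {ψ} φ) (hy : y ∉ ψ.FV) : QN4Provable (ψ.imp (.all y φ)) := by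
  refine rall (FO.substitutable_self y φ) hy (Finset.notMem_erase _ _) ?_
  rw [FO.subst_self]
  refine (deduction ?_).provable
  simpa using h

theorem ex_imp (h : QN4Deducible {φ} ψ) (hy : y ∉ ψ.FV) : QN4Provable ((FO.ex y φ).imp ψ) := by
  refine rex (FO.substitutable_self y φ) hy (Finset.notMem_erase _ _) ?_
  rw [FO.subst_self]
  refine (deduction ?_).provable
  simpa using h

/-- Elimination of a falsified bounded universal quantifier. -/
theorem neg_all_imp (h : QN4Deducible {α.neg, ε} ψ) (hy : y ∉ ψ.FV) :
    QN4Provable ((FO.all y (ε.imp α)).neg.imp ψ) := by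
  have h' : QN4Provable ((FO.ex y (ε.imp α).neg).imp ψ) := by
    refine ex_imp ?_ hy
    have key : QN4Deducible {(ε.imp α).neg} (ε.and α.neg) := iff_mp (.n4 _ _) (.prem rfl)
    have h₀ : QN4Deducible ∅ (ε.imp (α.neg.imp ψ)) := by
      refine deduction (deduction ?_)
      simpa using h
    exact .mp (and_right key) (.mp (and_left key) (h₀.mono (Set.empty_subset _)))
  exact (deduction (.mp (iff_mp (.n6 _ _) hyp) (.thm h'))).provable

theorem all_nec (h : QN4Provable φ) : QN4Provable (.all y φ) := by
  -- The quantifier rule needs an antecedent; any theorem without `y` free will do.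
  have hy : y ∉ ((FO.all y φ).imp (.all y φ)).FV := by simp [FO.FV]
  exact .mp (deduction hyp).provable (imp_all (.thm h) hy)

theorem box_imp_distrib : QN4Provable ((FO.all y (ε.imp (α.imp β))).imp
    ((FO.all y (ε.imp α)).imp (.all y (ε.imp β)))) := by
  have h : QN4Provable (((FO.all y (ε.imp (α.imp β))).and (FO.all y (ε.imp α))).imp
      (.all y (ε.imp β))) := by
    refine imp_all (deduction ?_) (by simp [FO.FV])
    have h := (QN4Deducible.prem (Set.mem_singleton
      ((FO.all y (ε.imp (α.imp β))).and (FO.all y (ε.imp α))))).weaken (ψ := ε)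
    exact .mp (.mp hyp (all_elim (and_right h))) (.mp hyp (all_elim (and_left h)))
  exact (deduction (deduction (.mp (and_intro hyp.weaken hyp) (.thm h)))).provable

theorem box_imp_dia : QN4Provable ((FO.all y (ε.imp (α.imp β))).imp
    ((FO.all y (ε.imp α.neg)).neg.imp (FO.all y (ε.imp β.neg)).neg)) := by
  have h : QN4Provable ((FO.all y (ε.imp α.neg)).neg.imp
      ((FO.all y (ε.imp (α.imp β))).imp (FO.all y (ε.imp β.neg)).neg)) := by
    refine neg_all_imp (deduction ?_) (by simp [FO.FV])
    have hε : QN4Deducible {FO.all y (ε.imp (α.imp β)), α.neg.neg, ε} ε := prem (by simp)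
    have hα : QN4Deducible {FO.all y (ε.imp (α.imp β)), α.neg.neg, ε} α :=
      iff_mp (.n1 _) (.prem (by simp))
    exact neg_all_intro hε (iff_mpr (.n1 _) (.mp hα (.mp hε (all_elim hyp))))
  exact (deduction (deduction (.mp hyp.weaken (.mp hyp (.thm h))))).provable

theorem dia_or : QN4Provable ((FO.all y (ε.imp (α.or β).neg)).neg.imp
    ((FO.all y (ε.imp α.neg)).neg.or (FO.all y (ε.imp β.neg)).neg)) := by
  refine neg_all_imp ?_ (by simp [FO.FV])
  refine or_elim (iff_mp (.n1 _) hyp) ?_ ?_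
  · exact .mp (neg_all_intro (.prem (by simp)) (iff_mpr (.n1 _) hyp)) (.ax (.a6 _ _))
  · exact .mp (neg_all_intro (.prem (by simp)) (iff_mpr (.n1 _) hyp)) (.ax (.a7 _ _))

/-- Fischer Servi's law: given `ε` and `α`, the variable `y` is itself a witness for ◇`α`, so □`β`
follows and is instantiated at `y`. It yields (c2) in the canonical model. -/
theorem dia_imp_box : QN4Provable (((FO.all y (ε.imp α.neg)).neg.imp (.all y (ε.imp β))).imp
    (.all y (ε.imp (α.imp β)))) := by
  refine imp_all (deduction (deduction ?_)) (by simp [FO.FV])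
  have h : QN4Deducible {α, ε, (FO.all y (ε.imp α.neg)).neg.imp (.all y (ε.imp β))}
      ((FO.all y (ε.imp α.neg)).neg.imp (.all y (ε.imp β))) := .prem (by simp)
  exact .mp hyp.weaken (all_elim (.mp (neg_all_intro hyp.weaken (iff_mpr (.n1 _) hyp)) h))

/-- Strong negation does not respect provable equivalence, so exchanging `α` and `∼∼α` below it
needs a derivation of its own. -/
theorem neg_box_imp : QN4Provable ((FO.all y (ε.imp α)).neg.imp
    (FO.all y (ε.imp α.neg.neg)).neg) :=
  neg_all_imp (neg_all_intro (.prem (by simp)) (iff_mpr (.n1 _) hyp)) (by simp [FO.FV])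

theorem imp_neg_box : QN4Provable ((FO.all y (ε.imp α.neg.neg)).neg.imp
    (FO.all y (ε.imp α)).neg) :=
  neg_all_imp (neg_all_intro (.prem (by simp)) (iff_mp (.n1 _) hyp)) (by simp [FO.FV])

end QN4Provable

/-! ## The modal logic of `QN4`-provable translations -/

/-- The strong dual of the box. -/
def MD.dia (φ : MD) : MD := .neg (.box (.neg φ))

/-- Modal formulas all of whose standard translations are theorems of `QN4`. -/
def ModalThm (next : Ind → Ind) (φ : MD) : Prop := ∀ x, QN4Provable (stdTrans next φ x)

/-- Deductions from modal premises and theorems by modus ponens. -/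
inductive ModalDed (next : Ind → Ind) (T : Set MD) : MD → Prop
  | prem {φ} : φ ∈ T → ModalDed next T φ
  | thm {φ} : ModalThm next φ → ModalDed next T φ
  | mp {φ ψ} : ModalDed next T φ → ModalDed next T (.imp φ ψ) → ModalDed next T ψ

variable {next : Ind → Ind}

namespace ModalThm

open QN4Deducible

variable {φ ψ χ : MD}

theorem mp (h₁ : ModalThm next φ) (h₂ : ModalThm next (.imp φ ψ)) : ModalThm next ψ :=
  fun x => .mp (h₁ x) (h₂ x)

theorem imp_self (φ : MD) : ModalThm next (.imp φ φ) := fun _ => (deduction hyp).provable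

theorem imp_trans (h₁ : ModalThm next (.imp φ ψ)) (h₂ : ModalThm next (.imp ψ χ)) :
    ModalThm next (.imp φ χ) :=
  fun x => (deduction (.mp (.mp hyp (.thm (h₁ x))) (.thm (h₂ x)))).provable

theorem and_left (φ ψ : MD) : ModalThm next (.imp (.and φ ψ) φ) := fun _ => .ax (.a3 _ _)

theorem and_right (φ ψ : MD) : ModalThm next (.imp (.and φ ψ) ψ) := fun _ => .ax (.a4 _ _)

theorem or_left (φ ψ : MD) : ModalThm next (.imp φ (.or φ ψ)) := fun _ => .ax (.a6 _ _)

theorem or_right (φ ψ : MD) : ModalThm next (.imp ψ (.or φ ψ)) := fun _ => .ax (.a7 _ _)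

theorem or_imp (h₁ : ModalThm next (.imp φ χ)) (h₂ : ModalThm next (.imp ψ χ)) :
    ModalThm next (.imp (.or φ ψ) χ) :=
  fun x => .mp (h₂ x) (.mp (h₁ x) (.ax (.a8 _ _ _)))

/-- This is why `ModalThm` asks for all variables: the translation of □`φ` at `x` contains that of
`φ` at `next x`. -/
theorem nec (h : ModalThm next φ) : ModalThm next (.box φ) :=
  fun x => .all_nec (QN4Deducible.thm (h (next x))).deduction.provable

theorem box_imp_distrib (φ ψ : MD) :
    ModalThm next (.imp (.box (.imp φ ψ)) (.imp (.box φ) (.box ψ))) := fun _ => .box_imp_distrib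

theorem box_imp_dia (φ ψ : MD) :
    ModalThm next (.imp (.box (.imp φ ψ)) (.imp φ.dia ψ.dia)) := fun _ => .box_imp_dia

theorem dia_or (φ ψ : MD) : ModalThm next (.imp (MD.or φ ψ).dia (.or φ.dia ψ.dia)) :=
  fun _ => .dia_or

theorem dia_imp_box (φ ψ : MD) :
    ModalThm next (.imp (.imp φ.dia (.box ψ)) (.box (.imp φ ψ))) := fun _ => .dia_imp_box

theorem box_mono (h : ModalThm next (.imp φ ψ)) : ModalThm next (.imp (.box φ) (.box ψ)) :=
  h.nec.mp (box_imp_distrib _ _)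

theorem dia_mono (h : ModalThm next (.imp φ ψ)) : ModalThm next (.imp φ.dia ψ.dia) :=
  h.nec.mp (box_imp_dia _ _)

end ModalThm

-- Modal deductions from premises

namespace ModalDed

variable {T T' : Set MD} {φ ψ : MD}

theorem imp_intro (h : ModalDed next (insert φ T) ψ) : ModalDed next T (.imp φ ψ) := by
  induction h with
  | prem h =>
    rcases h with rfl | h
    · exact thm (.imp_self _)
    · exact mp (prem h) (thm fun _ => .ax (.a1 _ _))
  | thm h => exact mp (thm h) (thm fun _ => .ax (.a1 _ _))
  | mp _ _ ih₁ ih₂ => exact mp ih₁ (mp ih₂ (thm fun _ => .ax (.a2 _ _ _)))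

theorem mono (h : ModalDed next T φ) (hT : T ⊆ T') : ModalDed next T' φ := by
  induction h with
  | prem h => exact prem (hT h)
  | thm h => exact thm h
  | mp _ _ ih₁ ih₂ => exact mp ih₁ ih₂

theorem exists_mem_chain {c : Set (Set MD)} (hc : IsChain (· ⊆ ·) c) (hne : c.Nonempty)
    (h : ModalDed next (⋃₀ c) φ) : ∃ T ∈ c, ModalDed next T φ := by
  induction h with
  | prem h =>
    obtain ⟨T, hT, h⟩ := h
    exact ⟨T, hT, prem h⟩
  | thm h =>
    obtain ⟨T, hT⟩ := hne
    exact ⟨T, hT, thm h⟩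
  | mp _ _ ih₁ ih₂ =>
    obtain ⟨T₁, hT₁, h₁⟩ := ih₁
    obtain ⟨T₂, hT₂, h₂⟩ := ih₂
    rcases hc.total hT₁ hT₂ with h | h
    · exact ⟨T₂, hT₂, mp (h₁.mono h) h₂⟩
    · exact ⟨T₁, hT₁, mp h₁ (h₂.mono h)⟩

/-- Premises from a set that is downward directed for provable implication can be replaced by a
single one of its members. -/
theorem exists_imp_of_union {C : Set MD} (hne : C.Nonempty)
    (hC : ∀ γ₁ ∈ C, ∀ γ₂ ∈ C, ∃ γ ∈ C, ModalThm next (.imp γ γ₁) ∧ ModalThm next (.imp γ γ₂))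
    (h : ModalDed next (T ∪ C) φ) : ∃ γ ∈ C, ModalDed next T (.imp γ φ) := by
  have weak : ∀ {φ γ}, ModalDed next T φ → ModalDed next T (.imp γ φ) :=
    fun h => mp h (thm fun _ => .ax (.a1 _ _))
  have cut : ∀ {α β γ}, ModalThm next (.imp α β) → ModalDed next T (.imp β γ) →
      ModalDed next T (.imp α γ) :=
    fun h₁ h₂ => imp_intro (mp (mp (prem (Set.mem_insert _ _)) (thm h₁))
      (h₂.mono (Set.subset_insert _ _)))
  induction h with
  | @prem ψ h =>
    rcases h with h | h
    · obtain ⟨γ, hγ⟩ := hne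
      exact ⟨γ, hγ, weak (prem h)⟩
    · exact ⟨ψ, h, thm (.imp_self ψ)⟩
  | thm h =>
    obtain ⟨γ, hγ⟩ := hne
    exact ⟨γ, hγ, weak (thm h)⟩
  | mp _ _ ih₁ ih₂ =>
    obtain ⟨γ₁, hγ₁, h₁⟩ := ih₁
    obtain ⟨γ₂, hγ₂, h₂⟩ := ih₂
    obtain ⟨γ, hγ, h₃, h₄⟩ := hC γ₁ hγ₁ γ₂ hγ₂
    exact ⟨γ, hγ, mp (cut h₃ h₁) (mp (cut h₄ h₂) (thm fun _ => .ax (.a2 _ _ _)))⟩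

theorem deducible_stdTrans (h : ModalDed next T φ) (x : Ind) :
    QN4Deducible ((fun φ => stdTrans next φ x) '' T) (stdTrans next φ x) := by
  induction h with
  | prem h => exact .prem ⟨_, h, rfl⟩
  | thm h => exact .thm (h x)
  | mp _ _ ih₁ ih₂ => exact .mp ih₁ ih₂

end ModalDed

/-! ## The canonical model -/

/-- Prime theories; the set of all formulas is one of them. -/
structure PrimeTheory (next : Ind → Ind) where
  carrier : Set MD
  closed : ∀ φ, ModalDed next carrier φ → φ ∈ carrier
  prime : ∀ φ ψ, MD.or φ ψ ∈ carrier → φ ∈ carrier ∨ ψ ∈ carrier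

/-- Lindenbaum's lemma: theories extend to prime theories that avoid a given set closed under
disjunction. -/
theorem exists_primeTheory {T D : Set MD} (hD : ∀ δ₁ ∈ D, ∀ δ₂ ∈ D, MD.or δ₁ δ₂ ∈ D)
    (hT : ∀ δ ∈ D, ¬ ModalDed next T δ) :
    ∃ P : PrimeTheory next, T ⊆ P.carrier ∧ ∀ δ ∈ D, δ ∉ P.carrier := by
  obtain ⟨U, hTU, hU⟩ := zorn_subset_nonempty {U | ∀ δ ∈ D, ¬ ModalDed next U δ}
    (fun c hcS hc hne => ⟨⋃₀ c, fun δ hδ h => by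
      obtain ⟨V, hV, h⟩ := h.exists_mem_chain hc hne
      exact hcS hV δ hδ h, fun _ => Set.subset_sUnion_of_mem⟩) T hT
  -- By maximality and the deduction theorem, each formula outside `U` implies, over `U`, a formula
  -- to be avoided.
  have hmem : ∀ φ, φ ∉ U → ∃ δ ∈ D, ModalDed next U (.imp φ δ) := by
    intro φ hφ
    by_contra! hcon
    exact hφ (hU.2 (fun δ hδ h => hcon δ hδ h.imp_intro) (Set.subset_insert φ U)
      (Set.mem_insert φ U))
  refine ⟨⟨U, fun φ h => ?_, fun φ ψ h => ?_⟩, hTU, fun δ hδ h => hU.1 δ hδ (.prem h)⟩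
  · by_contra hφ
    obtain ⟨δ, hδ, h'⟩ := hmem φ hφ
    exact hU.1 δ hδ (.mp h h')
  · by_contra! hcon
    obtain ⟨δ₁, hδ₁, h₁⟩ := hmem φ hcon.1
    obtain ⟨δ₂, hδ₂, h₂⟩ := hmem ψ hcon.2
    have aux : ∀ {α δ δ'}, ModalDed next U (.imp α δ) → ModalThm next (.imp δ δ') →
        ModalDed next U (.imp α δ') := fun h h' => .imp_intro
      (.mp (.mp (.prem (Set.mem_insert _ _)) (h.mono (Set.subset_insert _ _))) (.thm h'))
    exact hU.1 _ (hD _ hδ₁ _ hδ₂) (.mp (.prem h) (.mp (aux h₂ (.or_right _ _))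
      (.mp (aux h₁ (.or_left _ _)) (.thm fun _ => .ax (.a8 _ _ _)))))

-- Prime theories and canonical accessibility

namespace PrimeTheory

variable {w v : PrimeTheory next} {φ ψ : MD}

theorem mem_of_thm (h : ModalThm next φ) : φ ∈ w.carrier := w.closed _ (.thm h)

theorem mem_of_imp_mem (h : MD.imp φ ψ ∈ w.carrier) (hφ : φ ∈ w.carrier) : ψ ∈ w.carrier :=
  w.closed _ (.mp (.prem hφ) (.prem h))

theorem mem_of_thm_imp (h : ModalThm next (.imp φ ψ)) (hφ : φ ∈ w.carrier) : ψ ∈ w.carrier :=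
  mem_of_imp_mem (mem_of_thm h) hφ

theorem mem_iff_of_axiom
    (h : ∀ x, QN4Axiom (FO.iff (stdTrans next φ x) (stdTrans next ψ x))) :
    φ ∈ w.carrier ↔ ψ ∈ w.carrier :=
  ⟨mem_of_thm_imp fun x => .mp (.ax (h x)) (.ax (.a3 _ _)),
    mem_of_thm_imp fun x => .mp (.ax (h x)) (.ax (.a4 _ _))⟩

theorem and_mem : MD.and φ ψ ∈ w.carrier ↔ φ ∈ w.carrier ∧ ψ ∈ w.carrier :=
  ⟨fun h => ⟨mem_of_thm_imp (.and_left _ _) h, mem_of_thm_imp (.and_right _ _) h⟩,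
    fun ⟨h₁, h₂⟩ => mem_of_imp_mem (mem_of_thm_imp (fun _ => .ax (.a5 _ _)) h₁) h₂⟩

theorem or_mem : MD.or φ ψ ∈ w.carrier ↔ φ ∈ w.carrier ∨ ψ ∈ w.carrier :=
  ⟨w.prime _ _, Or.rec (mem_of_thm_imp (.or_left _ _)) (mem_of_thm_imp (.or_right _ _))⟩

theorem neg_neg_mem : φ.neg.neg ∈ w.carrier ↔ φ ∈ w.carrier :=
  mem_iff_of_axiom fun _ => .n1 _

theorem neg_and_mem : (MD.and φ ψ).neg ∈ w.carrier ↔ φ.neg ∈ w.carrier ∨ ψ.neg ∈ w.carrier :=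
  (mem_iff_of_axiom (φ := (φ.and ψ).neg) (ψ := .or φ.neg ψ.neg) fun _ => .n2 _ _).trans or_mem

theorem neg_or_mem : (MD.or φ ψ).neg ∈ w.carrier ↔ φ.neg ∈ w.carrier ∧ ψ.neg ∈ w.carrier :=
  (mem_iff_of_axiom (φ := (φ.or ψ).neg) (ψ := .and φ.neg ψ.neg) fun _ => .n3 _ _).trans and_mem

theorem neg_imp_mem : (MD.imp φ ψ).neg ∈ w.carrier ↔ φ ∈ w.carrier ∧ ψ.neg ∈ w.carrier :=
  (mem_iff_of_axiom (φ := (φ.imp ψ).neg) (ψ := .and φ ψ.neg) fun _ => .n4 _ _).trans and_mem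

theorem box_mem_of_ded (h : ModalDed next {β | MD.box β ∈ w.carrier} φ) :
    MD.box φ ∈ w.carrier := by
  induction h with
  | prem h => exact h
  | thm h => exact mem_of_thm h.nec
  | mp _ _ ih₁ ih₂ => exact mem_of_imp_mem (mem_of_thm_imp (.box_imp_distrib _ _) ih₂) ih₁

theorem neg_box_mem : (MD.box φ).neg ∈ w.carrier ↔ φ.neg.dia ∈ w.carrier :=
  ⟨mem_of_thm_imp fun _ => .neg_box_imp, mem_of_thm_imp fun _ => .imp_neg_box⟩

/-- Canonical accessibility. -/
def Acc (w v : PrimeTheory next) : Prop :=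
  (∀ φ, MD.box φ ∈ w.carrier → φ ∈ v.carrier) ∧ ∀ φ ∈ v.carrier, φ.dia ∈ w.carrier

/-- The successor must avoid every δ with ◇δ ∉ `w`, a set closed under ∨ because ◇ distributes over
∨. Deriving such a δ would put □(γ → δ) in `w` for some γ ∈ `C`, hence ◇δ. With `C` a prime theory
this gives (c1), with a singleton the falsified box. -/
theorem exists_acc_of_dia_mem (w : PrimeTheory next) {C : Set MD} (hne : C.Nonempty)
    (hC : ∀ γ₁ ∈ C, ∀ γ₂ ∈ C, ∃ γ ∈ C, ModalThm next (.imp γ γ₁) ∧ ModalThm next (.imp γ γ₂))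
    (h : ∀ γ ∈ C, γ.dia ∈ w.carrier) : ∃ v, w.Acc v ∧ C ⊆ v.carrier := by
  obtain ⟨v, hv, hD⟩ := exists_primeTheory (next := next)
    (T := {β | MD.box β ∈ w.carrier} ∪ C) (D := {δ | δ.dia ∉ w.carrier})
    (fun δ₁ h₁ δ₂ h₂ h => (or_mem.1 (mem_of_thm_imp (.dia_or _ _) h)).elim h₁ h₂) (by
      intro δ hδ hded
      obtain ⟨γ, hγ, hded⟩ := hded.exists_imp_of_union hne hC
      exact hδ (mem_of_imp_mem (mem_of_thm_imp (.box_imp_dia _ _) (box_mem_of_ded hded)) (h γ hγ)))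
  exact ⟨v, ⟨fun φ hφ => hv (Or.inl hφ), fun φ hφ => by_contra fun h => hD φ h hφ⟩,
    fun γ hγ => hv (Or.inr hγ)⟩

/-- The extension must contain ◇γ for γ ∈ `v` and avoid □δ for δ ∉ `v`. If this were impossible, ◇γ
→ □δ would lie in `w`, so □(γ → δ) too, and δ would be in `v`. Used for (c2) and for the verified
box. -/
theorem exists_le_acc (w v : PrimeTheory next)
    (h : ∀ φ, MD.box φ ∈ w.carrier → φ ∈ v.carrier) :
    ∃ w' : PrimeTheory next, w.carrier ⊆ w'.carrier ∧ w'.Acc v := by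
  obtain ⟨w', hw, hD⟩ := exists_primeTheory (next := next)
    (T := w.carrier ∪ MD.dia '' v.carrier)
    -- Taking all formulas that imply some □δ makes the set closed under ∨, as □δ₁ ∨ □δ₂ implies
    -- □(δ₁ ∨ δ₂).
    (D := {ψ | ∃ δ ∉ v.carrier, ModalThm next (.imp ψ (.box δ))}) (by
      rintro ψ₁ ⟨δ₁, h₁, h₁'⟩ ψ₂ ⟨δ₂, h₂, h₂'⟩
      exact ⟨.or δ₁ δ₂, fun h => (or_mem.1 h).elim h₁ h₂,
        .or_imp (h₁'.imp_trans (.box_mono (.or_left _ _)))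
          (h₂'.imp_trans (.box_mono (.or_right _ _)))⟩) (by
      rintro ψ ⟨δ, hδ, hψ⟩ hded
      obtain ⟨_, ⟨γ, hγ, rfl⟩, hded⟩ := hded.exists_imp_of_union
        ⟨_, Set.mem_image_of_mem _ (mem_of_thm (.imp_self (.atom 0)))⟩ (by
          rintro _ ⟨γ₁, h₁, rfl⟩ _ ⟨γ₂, h₂, rfl⟩
          exact ⟨_, ⟨_, and_mem.2 ⟨h₁, h₂⟩, rfl⟩, .dia_mono (.and_left _ _),
            .dia_mono (.and_right _ _)⟩)
      have hmem : MD.imp γ.dia (.box δ) ∈ w.carrier := w.closed _ (.imp_intro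
        (.mp (.mp (.prem (Set.mem_insert _ _)) (hded.mono (Set.subset_insert _ _))) (.thm hψ)))
      exact hδ (mem_of_imp_mem (h _ (mem_of_thm_imp (.dia_imp_box _ _) hmem)) hγ))
  exact ⟨w', fun φ hφ => hw (Or.inl hφ),
    fun φ hφ => by_contra fun h => hD _ ⟨φ, h, .imp_self _⟩ hφ,
    fun φ hφ => hw (Or.inr ⟨φ, hφ, rfl⟩)⟩

theorem exists_notMem {T : Set MD} (h : ¬ ModalDed next T φ) :
    ∃ P : PrimeTheory next, T ⊆ P.carrier ∧ φ ∉ P.carrier := by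
  obtain ⟨P, hT, hP⟩ := exists_primeTheory (next := next) (T := T)
    (D := {ψ | ModalThm next (.imp ψ φ)}) (fun _ h₁ _ h₂ => .or_imp h₁ h₂)
    (fun ψ hψ hded => h (.mp hded (.thm hψ)))
  exact ⟨P, hT, hP φ (.imp_self φ)⟩

end PrimeTheory

open PrimeTheory

/-- The canonical model: prime theories ordered by inclusion. -/
def canonicalModel (next : Ind → Ind) : FSKdModel.{u} where
  World := ULift.{u} (PrimeTheory next)
  nonempty := ⟨⟨Set.univ, fun _ _ => trivial, fun _ _ _ => Or.inl trivial⟩⟩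
  le w v := w.down.carrier ⊆ v.down.carrier
  le_refl _ := subset_rfl
  le_trans _ _ _ := Set.Subset.trans
  acc w v := w.down.Acc v.down
  acc_forth w w' v hle hacc := by
    obtain ⟨v', hacc', hv⟩ := w'.down.exists_acc_of_dia_mem
      ⟨_, mem_of_thm (.imp_self (.atom 0))⟩
      (fun γ₁ h₁ γ₂ h₂ => ⟨_, and_mem.2 ⟨h₁, h₂⟩, .and_left _ _, .and_right _ _⟩)
      (fun γ hγ => hle (hacc.2 γ hγ))
    exact ⟨⟨v'⟩, hacc', hv⟩
  acc_back w v v' hacc hle := by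
    obtain ⟨w', hw, hacc'⟩ := w.down.exists_le_acc v'.down fun φ hφ => hle (hacc.1 φ hφ)
    exact ⟨⟨w'⟩, hw, hacc'⟩
  valPos n := {w | .atom n ∈ w.down.carrier}
  valNeg n := {w | .neg (.atom n) ∈ w.down.carrier}
  valPos_mono _ _ _ h hw := h hw
  valNeg_mono _ _ _ h hw := h hw

/-- The truth lemma. -/
theorem canonicalModel_truth (φ : MD) (w : (canonicalModel.{u} next).World) :
    ((canonicalModel next).Pos φ w ↔ φ ∈ w.down.carrier) ∧
      ((canonicalModel next).Neg φ w ↔ φ.neg ∈ w.down.carrier) := by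
  induction φ generalizing w with
  | atom n => exact ⟨.rfl, .rfl⟩
  | and φ ψ ih₁ ih₂ =>
    exact ⟨(and_congr (ih₁ w).1 (ih₂ w).1).trans and_mem.symm,
      (or_congr (ih₁ w).2 (ih₂ w).2).trans neg_and_mem.symm⟩
  | or φ ψ ih₁ ih₂ =>
    exact ⟨(or_congr (ih₁ w).1 (ih₂ w).1).trans or_mem.symm,
      (and_congr (ih₁ w).2 (ih₂ w).2).trans neg_or_mem.symm⟩
  | imp φ ψ ih₁ ih₂ =>
    refine ⟨⟨fun H => ?_, fun H v hv hφ => ?_⟩,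
      (and_congr (ih₁ w).1 (ih₂ w).2).trans neg_imp_mem.symm⟩
    · by_contra hcon
      obtain ⟨v, hv, hψ⟩ := exists_notMem (next := next) (T := insert φ w.down.carrier) (φ := ψ)
        fun h => hcon (w.down.closed _ h.imp_intro)
      exact hψ ((ih₂ ⟨v⟩).1.1 (H ⟨v⟩ (fun χ hχ => hv (Or.inr hχ))
        ((ih₁ ⟨v⟩).1.2 (hv (Or.inl rfl)))))
    · exact (ih₂ v).1.2 (mem_of_imp_mem (hv H) ((ih₁ v).1.1 hφ))
  | neg φ ih => exact ⟨(ih w).2, (ih w).1.trans neg_neg_mem.symm⟩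
  | box φ ih =>
    refine ⟨⟨fun H => ?_, fun H v hv t ht => (ih t).1.2 (ht.1 φ (hv H))⟩,
      ⟨fun ⟨t, ht, H⟩ => neg_box_mem.2 (ht.2 _ ((ih t).2.1 H)), fun H => ?_⟩⟩
    · by_contra hcon
      obtain ⟨v, hv, hφ⟩ := exists_notMem (next := next) fun h => hcon (box_mem_of_ded h)
      -- `w` itself need not access `v`, but the clause for □ quantifies over extensions of `w` as
      -- well.
      obtain ⟨w', hw, hacc⟩ := w.down.exists_le_acc v fun χ hχ => hv hχ
      exact hφ ((ih ⟨v⟩).1.1 (H ⟨w'⟩ hw ⟨v⟩ hacc))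
    · obtain ⟨v, hacc, hv⟩ := w.down.exists_acc_of_dia_mem (Set.singleton_nonempty φ.neg)
        (by rintro _ rfl _ rfl; exact ⟨_, rfl, .imp_self _, .imp_self _⟩)
        (by rintro _ rfl; exact neg_box_mem.1 H)
      exact ⟨⟨v⟩, hacc, (ih ⟨v⟩).2.2 (hv rfl)⟩

/-! ## Faithfulness of the translation -/

/-- Iterated modal disjunction. -/
def MD.bigOr : MD → List MD → MD
  | θ, [] => θ
  | θ, θ' :: l => .or θ (bigOr θ' l)

theorem stdTrans_bigOr (θ : MD) (l : List MD) (x : Ind) :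
    stdTrans next (θ.bigOr l) x =
      FO.bigOr (stdTrans next θ x) (l.map fun φ => stdTrans next φ x) := by
  induction l generalizing θ with
  | nil => rfl
  | cons θ' l ih => exact congrArg (FO.or _) (ih θ')

theorem ModalThm.imp_bigOr {θ χ : MD} {l : List MD} (h : χ ∈ θ :: l) :
    ModalThm next (.imp χ (θ.bigOr l)) := by
  induction l generalizing θ with
  | nil =>
    obtain rfl := List.mem_singleton.1 h
    exact .imp_self _
  | cons θ' l ih =>
    rcases List.mem_cons.1 h with rfl | h
    · exact .or_left _ _
    · exact (ih h).imp_trans (.or_right _ _)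

theorem ModalThm.bigOr_imp {θ χ : MD} {l : List MD}
    (h : ∀ ψ ∈ θ :: l, ModalThm next (.imp ψ χ)) : ModalThm next (.imp (θ.bigOr l) χ) := by
  induction l generalizing θ with
  | nil => exact h θ (by simp)
  | cons θ' l ih =>
    exact .or_imp (h θ (by simp)) (ih fun ψ hψ => h ψ (List.mem_cons_of_mem _ hψ))

theorem QN4Entails_of_FSKdEntails {Γ Δ : Set MD} (x : Ind) (h : FSKdEntails.{u} Γ Δ) :
    QN4Entails ((fun φ => stdTrans next φ x) '' Γ) ((fun φ => stdTrans next φ x) '' Δ) := by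
  by_contra hcon
  obtain ⟨P, hΓ, hΔ⟩ := exists_primeTheory (next := next) (T := Γ)
    -- For empty Δ nothing has to be avoided, and the trivial theory is admitted.
    (D := {ψ | ∃ θ l, (∀ χ ∈ θ :: l, χ ∈ Δ) ∧ ModalThm next (.imp ψ (MD.bigOr θ l))}) (by
      rintro ψ₁ ⟨θ₁, l₁, h₁, h₁'⟩ ψ₂ ⟨θ₂, l₂, h₂, h₂'⟩
      refine ⟨θ₁, l₁ ++ θ₂ :: l₂, fun χ hχ => ?_, .or_imp
        (h₁'.imp_trans (.bigOr_imp fun ψ hψ => .imp_bigOr ?_))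
        (h₂'.imp_trans (.bigOr_imp fun ψ hψ => .imp_bigOr ?_))⟩
      · rw [← List.cons_append, List.mem_append] at hχ
        exact hχ.elim (h₁ χ) (h₂ χ)
      · rw [← List.cons_append]
        exact List.mem_append_left _ hψ
      · rw [← List.cons_append]
        exact List.mem_append_right _ hψ) (by
      rintro ψ ⟨θ, l, hl, hψ⟩ hded
      refine hcon ⟨stdTrans next θ x, l.map fun φ => stdTrans next φ x, ?_, ?_⟩
      · intro χ hχ
        obtain ⟨ψ, hψ, rfl⟩ := List.mem_map.1
          (show χ ∈ (θ :: l).map fun φ => stdTrans next φ x from hχ)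
        exact ⟨ψ, hl ψ hψ, rfl⟩
      · rw [← stdTrans_bigOr]
        exact (ModalDed.mp hded (.thm hψ)).deducible_stdTrans x)
  obtain ⟨ψ, hψ, H⟩ := h (canonicalModel next) ⟨P⟩
    fun φ hφ => (canonicalModel_truth φ _).1.2 (hΓ hφ)
  exact hΔ ψ ⟨ψ, [], by simpa using hψ, .imp_self ψ⟩ ((canonicalModel_truth ψ _).1.1 H)

end NelsonModal

theorem theorem2 (next : NelsonModal.Ind → NelsonModal.Ind) (hnext : ∀ x, next x ≠ x)
    (Γ Δ : Set NelsonModal.MD) (x : NelsonModal.Ind) :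
    NelsonModal.FSKdEntails.{u} Γ Δ ↔
      NelsonModal.QN4Entails ((fun φ => NelsonModal.stdTrans next φ x) '' Γ)
        ((fun φ => NelsonModal.stdTrans next φ x) '' Δ) :=
  ⟨NelsonModal.QN4Entails_of_FSKdEntails x, NelsonModal.FSKdEntails_of_QN4Entails hnext⟩
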